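/- All graphs are finite. For a connected graph $\Gamma$ write $d$ for its distance function, $\Gamma_i(x)$ for the set of vertices at distance $i$ from $x$, and $d(x,T)=\min_{y\in T} d(x,y)$ for a nonempty vertex set $T$. A connected graph $\Gamma$ of diameter $D$ is distance-regular if there are integers $b_i,c_i$ $(0\le i\le D)$ such that, whenever $d(x,y)=i$, exactly $c_i$ neighbours of $y$ lie in $\Gamma_{i-1}(x)$ and exactly $b_i$ lie in $\Gamma_{i+1}(x)$; its valency is $k=b_0$. Let $\theta_{\min}$ be the smallest eigenvalue of its adjacency matrix. A Delsarte clique is a clique with $1+\frac{k}{-\theta_{\min}}$ vertices. $\Gamma$ is geometric with respect to a set $\mathcal C$ of Delsarte cliques (called lines) if every edge of $\Gamma$ lies in exactly one member of $\mathcal C$. In that case let $\phi_j$ be the number of vertices at distance $j$ from $x$ in a Delsarte clique $C$ with $d(x,C)=j$, and let $\tau_j$ be the number of lines through $x$ at distance $j-1$ from $y$, where $d(x,y)=j$; these numbers depend only on $j$. For $d(x,y)=2$ let $[x,y]$ be the set of lines $\ell$ containing $x$ with $d(y,\ell)=1$. $\Gamma$ has the equal line set (ELS) property if, for every vertex $x$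 and every line $\ell$ with $d(x,\ell)=1$, and for all distinct $y_1,y_2\in\ell$ at distance $2$ from $x$, we have $[x,y_1]=[x,y_2]$. For integers $v\ge k'\ge t\ge 0$ and $\lambda\ge 1$, a $t$-$(v,k',\lambda)$-design is a pair $(\mathcal P,\mathcal B)$ in which $\mathcal P$ is a set of $v$ elements and $\mathcal B$ is a set of $k'$-subsets of $\mathcal P$ such that each $t$-subset of $\mathcal P$ lies in exactly $\lambda$ members of $\mathcal B$. **Theorem.** Let $\Gamma$ be a geometric distance-regular graph with respect to $\mathcal C$, with smallest eigenvalue $\theta_{\min}$, diameter $D\ge 3$ and $\phi_1\ge 2$, that has the ELS property. Then the numbers $\phi_1$, $\phi_2$ and $\tau_2$ are well defined (they do not depend on the choice of the clique and the vertices), $r=-\theta_{\min}$ is an integer, and the following hold. 1. For each vertex $x$, let $\mathcal L$ be the set of lines through $x$ and $\mathcal B=\{[x,z] : z\in\Gamma_2(x)\}$. Then $(\mathcal L,\mathcal B)$ is a $2$-$(r,\tau_2,1)$-design. 2. $r\ge \tau_2(\tau_2-1)+1$. 3. $\phi_2\ge \tau_2(\phi_1-1)+1$. -/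

import Mathlib

namespace GeomDRG

/-- `G` is distance-regular: it is connected and there are numbers `c i`, `b i` such that, whenever
`d(x, y) = i`, exactly `c i` neighbours of `y` are at distance `i - 1` from `x` and exactly `b i`
neighbours of `y` are at distance `i + 1` from `x`. -/
def IsDistanceRegular {V : Type*} (G : SimpleGraph V) : Prop :=
  G.Connected ∧ ∃ b c : ℕ → ℕ, ∀ (i : ℕ) (x y : V), G.dist x y = i →
    {z : V | G.Adj y z ∧ G.dist x z + 1 = i}.ncard = c i ∧
    {z : V | G.Adj y z ∧ G.dist x z = i + 1}.ncard = b i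

open Classical in
/-- The smallest eigenvalue `θ_min` of the adjacency matrix of a (nonempty) finite graph. -/
noncomputable def minEigenvalue {V : Type*} [Fintype V] (G : SimpleGraph V) : ℝ :=
  sInf {θ : ℝ | Module.End.HasEigenvalue (Matrix.mulVecLin (G.adjMatrix ℝ)) θ}

/-- A Delsarte clique of a `k`-regular graph: a clique with `1 + k / (-θ_min)` vertices. -/
def IsDelsarteClique {V : Type*} [Fintype V] (G : SimpleGraph V) (C : Set V) : Prop :=
  G.IsClique C ∧ ∃ k : ℕ, (∀ x : V, (G.neighborSet x).ncard = k) ∧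
    (C.ncard : ℝ) = 1 + (k : ℝ) / (-minEigenvalue G)

/-- `G` is a geometric distance-regular graph with respect to the set `𝒞` of Delsarte cliques
(the lines): every edge of `G` lies in exactly one member of `𝒞`. -/
def IsGeometric {V : Type*} [Fintype V] (G : SimpleGraph V) (𝒞 : Set (Set V)) : Prop :=
  IsDistanceRegular G ∧ (∀ C ∈ 𝒞, IsDelsarteClique G C) ∧
    ∀ x y : V, G.Adj x y → ∃! C : Set V, C ∈ 𝒞 ∧ x ∈ C ∧ y ∈ C

/-- The distance `d(x, T) = min {d(x, y) | y ∈ T}` from a vertex to a (nonempty) vertex set. -/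
noncomputable def distToSet {V : Type*} (G : SimpleGraph V) (x : V) (T : Set V) : ℕ :=
  sInf ((fun y => G.dist x y) '' T)

/-- The values, over all pairs of a Delsarte clique `C` and a vertex `x` with `d(x, C) = j`, of
the number of vertices of `C` at distance `j` from `x`. -/
def phiValues {V : Type*} [Fintype V] (G : SimpleGraph V) (j : ℕ) : Set ℕ :=
  {n | ∃ (C : Set V) (x : V), IsDelsarteClique G C ∧ distToSet G x C = j ∧
    n = {y ∈ C | G.dist x y = j}.ncard}

/-- The geometric parameter `φ_j`: the common value of the numbers in `phiValues G j`. -/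
noncomputable def phi {V : Type*} [Fintype V] (G : SimpleGraph V) (j : ℕ) : ℕ :=
  sInf (phiValues G j)

/-- The values, over all pairs of vertices `x`, `y` with `d(x, y) = j`, of the number of lines
containing `x` that are at distance `j - 1` from `y`. -/
def tauValues {V : Type*} (G : SimpleGraph V) (𝒞 : Set (Set V)) (j : ℕ) : Set ℕ :=
  {n | ∃ x y : V, G.dist x y = j ∧ n = {ℓ ∈ 𝒞 | x ∈ ℓ ∧ distToSet G y ℓ + 1 = j}.ncard}

/-- The geometric parameter `τ_j`: the common value of the numbers in `tauValues G 𝒞 j`. -/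
noncomputable def tau {V : Type*} (G : SimpleGraph V) (𝒞 : Set (Set V)) (j : ℕ) : ℕ :=
  sInf (tauValues G 𝒞 j)

/-- The set `[x, y]` of the lines containing `x` at distance `1` from `y`. -/
def lineSet {V : Type*} (G : SimpleGraph V) (𝒞 : Set (Set V)) (x y : V) : Set (Set V) :=
  {ℓ ∈ 𝒞 | x ∈ ℓ ∧ distToSet G y ℓ = 1}

/-- The equal line set (ELS) property. -/
def HasELS {V : Type*} (G : SimpleGraph V) (𝒞 : Set (Set V)) : Prop :=
  ∀ (x : V), ∀ ℓ ∈ 𝒞, distToSet G x ℓ = 1 →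
    ∀ y₁ ∈ ℓ, ∀ y₂ ∈ ℓ, y₁ ≠ y₂ → G.dist x y₁ = 2 → G.dist x y₂ = 2 →
      lineSet G 𝒞 x y₁ = lineSet G 𝒞 x y₂

/-- `(P, B)` is a `t`-`(v, k, lam)`-design: `v ≥ k ≥ t ≥ 0`, `lam ≥ 1`, `P` is a set of `v`
elements, `B` is a set of `k`-subsets of `P`, and every `t`-subset of `P` lies in exactly `lam`
members of `B`. -/
def IsDesign {α : Type*} (t v k lam : ℕ) (P : Set α) (B : Set (Set α)) : Prop :=
  t ≤ k ∧ k ≤ v ∧ 1 ≤ lam ∧ P.Finite ∧ P.ncard = v ∧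
    (∀ b ∈ B, b ⊆ P ∧ b.ncard = k) ∧
    ∀ T : Set α, T ⊆ P → T.ncard = t → {b ∈ B | T ⊆ b}.ncard = lam

end GeomDRG

/-! `ELSGeometry` isolates the incidence facts that matter: a vertex at distance 1 from a line has
exactly φ₁ ≥ 2 neighbours on it, lines have at least φ₁ + 2 points, and ELS holds. The constant φ₁
is used mostly through one remark: neighbour sets of two vertices on a line cannot be properly
nested.

Moving x along a line and applying ELS transports equalities of line sets (`lineSet_eq_of_mem`).
Hence two distinct lines through x lie in at most one set [x, z] (`lineSet_unique`); they lie in at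
least one by `exists_mem_lineSet`. This is the design.

For the inequalities take d(x, u) = 2, d(x, y) = 3 and the line C = uy. In the design at u, C is a
point off the block [u, x]; joining it to the τ₂ points of that block bounds r. Next choose a
neighbour of u on each line of [x, u]. Its neighbours on C are φ₁ vertices at distance 2 from x, and
two such neighbour sets meet only in u, because vertices of C at distance 2 from x have distinct
line sets (`lineSet_ne`). This bounds φ₂.

That φ_j is constant is spectral: a nonzero eigenmatrix for θ_min in the adjacency algebra
annihilates the characteristic vector of every Delsarte clique, which gives a linear equation for
φ_j. Constancy of τ₂ follows from c₂ = τ₂φ₁, and r counts the lines through a vertex. -/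

namespace GeomDRG

/-! ### Line sets under the ELS property -/

section Geometry

variable {V : Type*} {G : SimpleGraph V} {𝒞 : Set (Set V)}

theorem exists_adj_of_dist_eq_succ (hG : G.Connected) {x y : V} {i : ℕ}
    (h : G.dist x y = i + 1) : ∃ z, G.Adj z y ∧ G.dist x z = i := by
  obtain ⟨p, hp⟩ := hG.exists_walk_length_eq_dist y x
  rw [G.dist_comm, h] at hp
  cases p with
  | nil => simp at hp
  | @cons _ z _ hz q =>
    refine ⟨z, hz.symm, ?_⟩
    have h1 : G.dist z x ≤ q.length := G.dist_le q
    have h2 : G.dist x y ≤ G.dist x z + G.dist z y := hG.dist_triangle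
    have h3 : G.dist z y = 1 := G.dist_eq_one_iff_adj.2 hz.symm
    rw [SimpleGraph.Walk.length_cons] at hp
    rw [G.dist_comm] at h1
    omega

theorem dist_le_dist_succ_of_adj (hG : G.Connected) {x y z : V} (h : G.Adj y z) :
    G.dist x y ≤ G.dist x z + 1 := by
  have h2 : G.dist x y ≤ G.dist x z + G.dist z y := hG.dist_triangle
  rwa [G.dist_eq_one_iff_adj.2 h.symm] at h2

theorem dist_eq_two (hG : G.Connected) {x y z : V} (hxz : x ≠ z) (h : ¬ G.Adj x z)
    (h1 : G.Adj x y) (h2 : G.Adj y z) : G.dist x z = 2 := by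
  have := hG.one_lt_dist_of_ne_of_not_adj hxz h
  have h3 := dist_le_dist_succ_of_adj hG (x := x) h2.symm
  rw [G.dist_eq_one_iff_adj.2 h1] at h3
  omega

theorem ne_of_dist_eq_two {x z : V} (h : G.dist x z = 2) : x ≠ z := by
  rintro rfl; simp at h

theorem not_adj_of_dist_eq_two {x z : V} (h : G.dist x z = 2) : ¬ G.Adj x z := by
  intro h'; rw [G.dist_eq_one_iff_adj.2 h'] at h; omega

theorem distToSet_le {x y : V} {T : Set V} (h : y ∈ T) : distToSet G x T ≤ G.dist x y :=
  Nat.sInf_le ⟨y, h, rfl⟩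

theorem exists_dist_eq_distToSet (x : V) {T : Set V} (h : T.Nonempty) :
    ∃ y ∈ T, G.dist x y = distToSet G x T :=
  Nat.sInf_mem (h.image (fun y => G.dist x y))

theorem distToSet_eq_of_forall_le {x y : V} {T : Set V} {n : ℕ} (hy : y ∈ T)
    (h : G.dist x y = n) (hT : ∀ z ∈ T, n ≤ G.dist x z) : distToSet G x T = n := by
  obtain ⟨z, hz, hz'⟩ := exists_dist_eq_distToSet (G := G) x ⟨y, hy⟩
  have := distToSet_le (G := G) (x := x) hy
  have := hT z hz
  omega

theorem distToSet_eq_one_iff (hG : G.Connected) {x : V} {T : Set V} :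
    distToSet G x T = 1 ↔ x ∉ T ∧ ∃ y ∈ T, G.Adj x y := by
  constructor
  · intro h
    have hne : T.Nonempty := by
      by_contra hT
      rw [Set.not_nonempty_iff_eq_empty] at hT
      simp [hT, distToSet] at h
    refine ⟨fun hx => ?_, ?_⟩
    · have := distToSet_le (G := G) (x := x) hx
      rw [h, G.dist_self] at this
      omega
    · obtain ⟨y, hy, hy'⟩ := exists_dist_eq_distToSet (G := G) x hne
      exact ⟨y, hy, G.dist_eq_one_iff_adj.1 (hy'.trans h)⟩
  · rintro ⟨hx, y, hy, hxy⟩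
    refine distToSet_eq_of_forall_le hy (G.dist_eq_one_iff_adj.2 hxy) fun z hz => ?_
    exact hG.pos_dist_of_ne fun h => hx (h ▸ hz)

/-- Lines that are cliques covering every edge once, such that a point at distance `1` from a line
has exactly `φ ≥ 2` neighbours on it, all lines have at least `φ + 2` points, and the equal line set
property holds. -/
structure ELSGeometry (G : SimpleGraph V) (𝒞 : Set (Set V)) (φ : ℕ) : Prop where
  connected : G.Connected
  isClique : ∀ ℓ ∈ 𝒞, G.IsClique ℓ
  existsUnique_line : ∀ x y : V, G.Adj x y → ∃! ℓ : Set V, ℓ ∈ 𝒞 ∧ x ∈ ℓ ∧ y ∈ ℓ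
  ncard_adj : ∀ ℓ ∈ 𝒞, ∀ x ∉ ℓ, ∀ y ∈ ℓ, G.Adj x y → {z ∈ ℓ | G.Adj x z}.ncard = φ
  two_le : 2 ≤ φ
  add_two_le : ∀ ℓ ∈ 𝒞, φ + 2 ≤ ℓ.ncard
  els : HasELS G 𝒞

namespace ELSGeometry

variable {φ : ℕ}

theorem line_ext (h : ELSGeometry G 𝒞 φ)
    {ℓ m : Set V} (hℓ : ℓ ∈ 𝒞) (hm : m ∈ 𝒞) {x y : V} (hxy : x ≠ y)
    (h1 : x ∈ ℓ) (h2 : y ∈ ℓ) (h3 : x ∈ m) (h4 : y ∈ m) : ℓ = m :=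
  (h.existsUnique_line x y (h.isClique ℓ hℓ h1 h2 hxy)).unique ⟨hℓ, h1, h2⟩ ⟨hm, h3, h4⟩

theorem exists_line (h : ELSGeometry G 𝒞 φ)
    {x y : V} (hxy : G.Adj x y) : ∃ ℓ ∈ 𝒞, x ∈ ℓ ∧ y ∈ ℓ := by
  obtain ⟨ℓ, hℓ, -⟩ := h.existsUnique_line x y hxy
  exact ⟨ℓ, hℓ⟩

theorem notMem_of_not_adj (h : ELSGeometry G 𝒞 φ)
    {ℓ : Set V} (hℓ : ℓ ∈ 𝒞) {x y : V} (hx : x ∈ ℓ) (hxy : x ≠ y)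
    (hadj : ¬ G.Adj x y) : y ∉ ℓ :=
  fun hy => hadj (h.isClique ℓ hℓ hx hy hxy)

theorem notMem_of_dist_eq_two (h : ELSGeometry G 𝒞 φ)
    {ℓ : Set V} (hℓ : ℓ ∈ 𝒞) {x y : V} (hx : x ∈ ℓ)
    (hxy : G.dist x y = 2) : y ∉ ℓ :=
  h.notMem_of_not_adj hℓ hx (ne_of_dist_eq_two hxy) (not_adj_of_dist_eq_two hxy)

theorem mem_lineSet_iff (h : ELSGeometry G 𝒞 φ) {x y : V} (hxy : G.dist x y = 2) {ℓ : Set V} :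
    ℓ ∈ lineSet G 𝒞 x y ↔ ℓ ∈ 𝒞 ∧ x ∈ ℓ ∧ ∃ p ∈ ℓ, G.Adj y p := by
  refine and_congr_right fun hℓ => and_congr_right fun hx => ?_
  rw [distToSet_eq_one_iff h.connected]
  exact and_iff_right (h.notMem_of_dist_eq_two hℓ hx hxy)

theorem lineSet_eq (h : ELSGeometry G 𝒞 φ) {x y z : V} {ℓ : Set V} (hℓ : ℓ ∈ 𝒞) (hx : x ∉ ℓ)
    (hadj : ∃ p ∈ ℓ, G.Adj x p) (hy : y ∈ ℓ) (hz : z ∈ ℓ) (hxy : G.dist x y = 2)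
    (hxz : G.dist x z = 2) : lineSet G 𝒞 x y = lineSet G 𝒞 x z := by
  by_cases hyz : y = z
  · rw [hyz]
  · exact h.els x ℓ hℓ ((distToSet_eq_one_iff h.connected).2 ⟨hx, hadj⟩) y hy z hz hyz hxy hxz

theorem exists_ne_adj (h : ELSGeometry G 𝒞 φ)
    {ℓ : Set V} (hℓ : ℓ ∈ 𝒞) {x y : V} (hx : x ∉ ℓ) (hy : y ∈ ℓ)
    (hxy : G.Adj x y) : ∃ z ∈ ℓ, z ≠ y ∧ G.Adj x z := by
  have h1 := h.ncard_adj ℓ hℓ x hx y hy hxy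
  obtain ⟨z, hz, hzy⟩ := Set.exists_ne_of_one_lt_ncard (h1 ▸ h.two_le) y
  exact ⟨z, hz.1, hzy, hz.2⟩

/-- If ℓ meets the neighbours of z in w, the line zw carries a second neighbour v of x because φ ≥
2; the line xv is the new member. -/
theorem exists_ne_mem_lineSet (h : ELSGeometry G 𝒞 φ)
    {x z : V} (hxz : G.dist x z = 2) {ℓ : Set V}
    (hℓ : ℓ ∈ lineSet G 𝒞 x z) : ∃ m ∈ lineSet G 𝒞 x z, m ≠ ℓ := by
  obtain ⟨h1, hx, w, hw, hzw⟩ := (h.mem_lineSet_iff hxz).1 hℓ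
  have hzℓ := h.notMem_of_dist_eq_two h1 hx hxz
  obtain ⟨m, hm, hzm, hwm⟩ := h.exists_line hzw
  have hxm := h.notMem_of_dist_eq_two hm hzm (G.dist_comm ▸ hxz)
  have hxw : G.Adj x w := h.isClique ℓ h1 hx hw fun e => hxm (e ▸ hwm)
  obtain ⟨v, hv, hvw, hxv⟩ := h.exists_ne_adj hm hxm hwm hxw
  obtain ⟨n, hn, hxn, hvn⟩ := h.exists_line hxv
  refine ⟨n, (h.mem_lineSet_iff hxz).2 ⟨hn, hxn, v, hvn, ?_⟩, ?_⟩
  · refine h.isClique m hm hzm hv ?_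
    rintro rfl
    exact not_adj_of_dist_eq_two hxz hxv
  · rintro rfl
    exact hzℓ (h.line_ext h1 hm hvw hvn hw hv hwm ▸ hzm)

variable [Finite V]

/-- Two points at distance `1` from a line whose neighbours on it differ: some neighbour of `z`
on the line is not a neighbour of `w`. -/
theorem exists_adj_not_adj (h : ELSGeometry G 𝒞 φ)
    {ℓ : Set V} (hℓ : ℓ ∈ 𝒞) {x w z p : V} (hw : w ∉ ℓ) (hz : z ∉ ℓ)
    (hx : x ∈ ℓ) (hwx : G.Adj w x) (hzx : ¬ G.Adj z x) (hp : p ∈ ℓ) (hzp : G.Adj z p) :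
    ∃ q ∈ ℓ, G.Adj z q ∧ G.dist w q = 2 := by
  by_contra! hcon
  -- Every vertex of ℓ is within distance 2 of w, via x. Failure of the claim therefore nests two
  -- neighbour sets of the same size φ, so they coincide and z is adjacent to x.
  have hsub : {q ∈ ℓ | G.Adj z q} ⊆ {q ∈ ℓ | G.Adj w q} := by
    rintro q ⟨hq, hzq⟩
    refine ⟨hq, ?_⟩
    by_contra hwq
    refine hcon q hq hzq (dist_eq_two h.connected (fun e => hw (e ▸ hq)) hwq hwx ?_)
    exact h.isClique ℓ hℓ hx hq fun e => hzx (e ▸ hzq)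
  have heq := Set.eq_of_subset_of_ncard_le hsub
    (by rw [h.ncard_adj ℓ hℓ w hw x hx hwx, h.ncard_adj ℓ hℓ z hz p hp hzp])
  have : x ∈ {q ∈ ℓ | G.Adj z q} := heq ▸ ⟨hx, hwx⟩
  exact hzx this.2

theorem exists_not_adj (h : ELSGeometry G 𝒞 φ)
    {ℓ : Set V} (hℓ : ℓ ∈ 𝒞) {x y : V} (hx : x ∉ ℓ) (hy : y ∈ ℓ)
    (hxy : G.Adj x y) (w : V) : ∃ z ∈ ℓ, z ≠ w ∧ ¬ G.Adj x z := by
  by_contra! hcon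
  have h1 := h.ncard_adj ℓ hℓ x hx y hy hxy
  have hsub : ℓ ⊆ insert w {z ∈ ℓ | G.Adj x z} := fun z hz => by
    by_cases hzw : z = w
    · exact Or.inl hzw
    · exact Or.inr ⟨hz, hcon z hz hzw⟩
  have h2 := Set.ncard_le_ncard hsub
  have h3 := Set.ncard_insert_le w {z ∈ ℓ | G.Adj x z}
  have h4 := h.add_two_le ℓ hℓ
  omega

theorem exists_dist_two_of_line (h : ELSGeometry G 𝒞 φ)
    {ℓ : Set V} (hℓ : ℓ ∈ 𝒞) {x y : V} (hx : x ∉ ℓ) (hy : y ∈ ℓ)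
    (hxy : G.Adj x y) : ∃ z ∈ ℓ, G.dist x z = 2 := by
  obtain ⟨z, hz, hzy, hxz⟩ := h.exists_not_adj hℓ hx hy hxy y
  exact ⟨z, hz, dist_eq_two h.connected (fun e => hx (e ▸ hz)) hxz hxy
    (h.isClique ℓ hℓ hy hz hzy.symm)⟩

/-- Any two lines through `x` lie in a common line set. -/
theorem exists_mem_lineSet (h : ELSGeometry G 𝒞 φ)
    {x : V} {ℓ₁ ℓ₂ : Set V} (h1 : ℓ₁ ∈ 𝒞) (h2 : ℓ₂ ∈ 𝒞) (hne : ℓ₁ ≠ ℓ₂)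
    (hx1 : x ∈ ℓ₁) (hx2 : x ∈ ℓ₂) :
    ∃ z, G.dist x z = 2 ∧ ℓ₁ ∈ lineSet G 𝒞 x z ∧ ℓ₂ ∈ lineSet G 𝒞 x z := by
  obtain ⟨y, hy, hyx⟩ : ∃ y ∈ ℓ₂, y ≠ x :=
    Set.exists_ne_of_one_lt_ncard (by have := h.add_two_le ℓ₂ h2; omega) x
  have hy1 : y ∉ ℓ₁ := fun hy1 => hne (h.line_ext h1 h2 hyx hy1 hx1 hy hx2)
  obtain ⟨w, hw, hwx, hyw⟩ :=
    h.exists_ne_adj h1 hy1 hx1 (h.isClique ℓ₂ h2 hy hx2 hyx)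
  obtain ⟨m, hm, hym, hwm⟩ := h.exists_line hyw
  have hxm : x ∉ m := fun hxm => hy1 (h.line_ext h1 hm hwx hw hx1 hwm hxm ▸ hym)
  obtain ⟨z, hz, hxz⟩ := h.exists_dist_two_of_line hm hxm hym (h.isClique ℓ₂ h2 hx2 hy hyx.symm)
  refine ⟨z, hxz, (h.mem_lineSet_iff hxz).2 ⟨h1, hx1, w, hw, ?_⟩,
    (h.mem_lineSet_iff hxz).2 ⟨h2, hx2, y, hy, ?_⟩⟩
  · refine h.isClique m hm hz hwm ?_
    rintro rfl
    exact h.notMem_of_dist_eq_two h1 hx1 hxz hw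
  · refine h.isClique m hm hz hym ?_
    rintro rfl
    exact h.notMem_of_dist_eq_two h2 hx2 hxz hy

/-- ELS is applied three times. Pick q on ℓ adjacent to z with d(x', q) = 2, and let n be the line
zq. ELS along ℓ₁ gives [z, x] = [z, x'], so n contains a neighbour of x'; ELS along n then gives
[x', q] = [x', z], and along ℓ gives [x', p] = [x', q]. -/
theorem lineSet_eq_of_mem (h : ELSGeometry G 𝒞 φ)
    {x x' z p : V} {ℓ₁ ℓ : Set V} (hxx : x ≠ x') (hx' : x' ∈ ℓ₁)
    (hxz : G.dist x z = 2) (hxz' : G.dist x' z = 2) (h1 : ℓ₁ ∈ lineSet G 𝒞 x z)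
    (hℓ : ℓ ∈ lineSet G 𝒞 x z) (hne : ℓ ≠ ℓ₁) (hp : p ∈ ℓ) (hxp : G.dist x' p = 2) :
    lineSet G 𝒞 x' p = lineSet G 𝒞 x' z := by
  obtain ⟨h1, hx1, w, hw, hzw⟩ := (h.mem_lineSet_iff hxz).1 h1
  obtain ⟨hℓ, hx, v, hv, hzv⟩ := (h.mem_lineSet_iff hxz).1 hℓ
  have hzx : G.dist z x = 2 := by rwa [G.dist_comm]
  have hzx' : G.dist z x' = 2 := by rwa [G.dist_comm]
  have hx'ℓ : x' ∉ ℓ := fun hmem => hne (h.line_ext hℓ h1 hxx hx hmem hx1 hx')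
  have hzℓ := h.notMem_of_dist_eq_two hℓ hx hxz
  have hx'x : G.Adj x' x := h.isClique ℓ₁ h1 hx' hx1 hxx.symm
  obtain ⟨q, hq, hzq, hx'q⟩ := h.exists_adj_not_adj hℓ hx'ℓ hzℓ hx hx'x
    (not_adj_of_dist_eq_two hzx) hv hzv
  obtain ⟨n, hn, hzn, hqn⟩ := h.exists_line hzq
  have hxq : x ≠ q := by
    rintro rfl
    exact not_adj_of_dist_eq_two hzx hzq
  have hnx : n ∈ lineSet G 𝒞 z x :=
    (h.mem_lineSet_iff hzx).2 ⟨hn, hzn, q, hqn, h.isClique ℓ hℓ hx hq hxq⟩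
  rw [h.lineSet_eq h1 (h.notMem_of_dist_eq_two h1 hx1 hxz) ⟨w, hw, hzw⟩ hx1 hx' hzx hzx',
    h.mem_lineSet_iff hzx'] at hnx
  rw [h.lineSet_eq hℓ hx'ℓ ⟨x, hx, hx'x⟩ hp hq hxp hx'q,
    h.lineSet_eq hn (h.notMem_of_dist_eq_two hn hzn hzx') hnx.2.2 hqn hzn hx'q hxz']

/-- Two distinct lines through `x` determine the line set containing them. -/
theorem lineSet_unique (h : ELSGeometry G 𝒞 φ)
    {x z z' : V} {ℓ₁ ℓ₂ : Set V} (hxz : G.dist x z = 2)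
    (hxz' : G.dist x z' = 2) (hne : ℓ₁ ≠ ℓ₂) (h1 : ℓ₁ ∈ lineSet G 𝒞 x z)
    (h2 : ℓ₂ ∈ lineSet G 𝒞 x z) (h1' : ℓ₁ ∈ lineSet G 𝒞 x z') (h2' : ℓ₂ ∈ lineSet G 𝒞 x z') :
    lineSet G 𝒞 x z = lineSet G 𝒞 x z' := by
  obtain ⟨hℓ1, hx1, w, hw, hzw⟩ := (h.mem_lineSet_iff hxz).1 h1
  obtain ⟨hℓ2, hx2, v, hv, hzv⟩ := (h.mem_lineSet_iff hxz).1 h2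
  obtain ⟨-, -, w', hw', hzw'⟩ := (h.mem_lineSet_iff hxz').1 h1'
  obtain ⟨-, -, v', hv', hzv'⟩ := (h.mem_lineSet_iff hxz').1 h2'
  have hz1 := h.notMem_of_dist_eq_two hℓ1 hx1 hxz
  have hz1' := h.notMem_of_dist_eq_two hℓ1 hx1 hxz'
  have hz2' := h.notMem_of_dist_eq_two hℓ2 hx2 hxz'
  have hzx : G.dist z x = 2 := by rwa [G.dist_comm]
  have hzx' : G.dist z' x = 2 := by rwa [G.dist_comm]
  -- The comparison is made at a second vertex x' of ℓ₁ at distance 2 from z and then carried back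
  -- to x.
  obtain ⟨x', hx', hxx', hzn⟩ := h.exists_not_adj hℓ1 hz1 hw hzw x
  have hx'z : G.dist x' z = 2 := by
    rw [G.dist_comm]
    exact dist_eq_two h.connected (fun e => hz1 (e ▸ hx')) hzn hzw
      (h.isClique ℓ₁ hℓ1 hw hx' fun e => hzn (e ▸ hzw))
  have hx'x : G.Adj x' x := h.isClique ℓ₁ hℓ1 hx' hx1 hxx'
  have hx'2 : x' ∉ ℓ₂ := fun hmem => hne (h.line_ext hℓ1 hℓ2 hxx' hx' hx1 hmem hx2)
  have h1x' : ℓ₁ ∈ lineSet G 𝒞 x' z := (h.mem_lineSet_iff hx'z).2 ⟨hℓ1, hx', w, hw, hzw⟩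
  obtain ⟨q, hq, hzq, hx'q⟩ := h.exists_adj_not_adj hℓ2 hx'2 hz2' hx2 hx'x
    (not_adj_of_dist_eq_two hzx') hv' hzv'
  have hqz := h.lineSet_eq_of_mem hxx'.symm hx' hxz hx'z h1 h2 hne.symm hq hx'q
  -- If x' is adjacent to z', the line x'z' lies in [x', q] = [x', z], and transport back to x
  -- reaches z' itself. Otherwise [x', z] = [x', z'], and a further line m of this set carries a
  -- vertex p with [x, z] = [x, p] = [x, z'].
  by_cases hadj : G.Adj x' z'
  · obtain ⟨m, hm, hx'm, hz'm⟩ := h.exists_line hadj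
    have hm1 : m ≠ ℓ₁ := by
      rintro rfl
      exact hz1' hz'm
    have hmz : m ∈ lineSet G 𝒞 x' z :=
      hqz ▸ (h.mem_lineSet_iff hx'q).2 ⟨hm, hx'm, z', hz'm, hzq.symm⟩
    exact (h.lineSet_eq_of_mem hxx' hx1 hx'z hxz h1x' hmz hm1 hz'm hxz').symm
  · have hx'z' : G.dist x' z' = 2 := by
      have hne' : x' ≠ z' := fun e => hz1' (e ▸ hx')
      rw [G.dist_comm]
      exact dist_eq_two h.connected hne'.symm (fun e => hadj e.symm) hzw'
        (h.isClique ℓ₁ hℓ1 hw' hx' fun e => hadj (e ▸ hzw'.symm))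
    have hqz' := h.lineSet_eq_of_mem hxx'.symm hx' hxz' hx'z' h1' h2' hne.symm hq hx'q
    have h1x'' : ℓ₁ ∈ lineSet G 𝒞 x' z' := (h.mem_lineSet_iff hx'z').2 ⟨hℓ1, hx', w', hw', hzw'⟩
    obtain ⟨m, hm, hm1⟩ := h.exists_ne_mem_lineSet hx'z h1x'
    have hm' : m ∈ lineSet G 𝒞 x' z' := hqz' ▸ hqz ▸ hm
    obtain ⟨hmC, hx'm, u, hu, hzu⟩ := (h.mem_lineSet_iff hx'z).1 hm
    have hxm : x ∉ m := fun hmem => hm1 (h.line_ext hmC hℓ1 hxx' hx'm hmem hx' hx1)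
    obtain ⟨p, hp, -, hxp⟩ := h.exists_adj_not_adj hmC hxm
      (h.notMem_of_dist_eq_two hmC hx'm hx'z) hx'm hx'x.symm hzn hu hzu
    rw [← h.lineSet_eq_of_mem hxx' hx1 hx'z hxz h1x' hm hm1 hp hxp,
      h.lineSet_eq_of_mem hxx' hx1 hx'z' hxz' h1x'' hm' hm1 hp hxp]

end ELSGeometry

end Geometry

end GeomDRG

/-! ### The design and the two counting inequalities -/

namespace GeomDRG

theorem ncard_biUnion_eq_mul {α β : Type*} [Finite α] {T : Set β} (hT : T.Finite) (f : β → Set α)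
    (hdisj : T.PairwiseDisjoint f) {n : ℕ} (hn : ∀ b ∈ T, (f b).ncard = n) :
    (⋃ b ∈ T, f b).ncard = T.ncard * n := by
  induction T, hT using Set.Finite.induction_on with
  | empty => simp
  | @insert a T ha hT ih =>
    rw [Set.biUnion_insert, Set.ncard_union_eq ?_ (Set.toFinite _) (Set.toFinite _),
      Set.ncard_insert_of_notMem ha hT, hn a (Set.mem_insert _ _),
      ih (hdisj.subset (Set.subset_insert _ _)) fun b hb => hn b (Set.mem_insert_of_mem _ hb)]
    · ring
    · refine Set.disjoint_iUnion₂_right.2 fun b hb => ?_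
      exact hdisj (Set.mem_insert _ _) (Set.mem_insert_of_mem _ hb) fun e => ha (e ▸ hb)

section Geometry

variable {V : Type*} {G : SimpleGraph V} {𝒞 : Set (Set V)} {φ : ℕ}

theorem two_le_dist_of_mem_clique (hG : G.Connected) {C : Set V} (hC : G.IsClique C) {x y v : V}
    (hy : y ∈ C) (hxy : G.dist x y = 3) (hv : v ∈ C) : 2 ≤ G.dist x v := by
  by_cases hvy : y = v
  · rw [← hvy]; omega
  · have := dist_le_dist_succ_of_adj hG (x := x) (hC hy hv hvy)
    omega

namespace ELSGeometry

variable [Finite V]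

theorem two_le_ncard_lineSet (h : ELSGeometry G 𝒞 φ) {x z : V} (hxz : G.dist x z = 2) :
    2 ≤ (lineSet G 𝒞 x z).ncard := by
  obtain ⟨w, hwz, hxw⟩ := exists_adj_of_dist_eq_succ h.connected hxz
  obtain ⟨ℓ, hℓ, hx, hw⟩ := h.exists_line (G.dist_eq_one_iff_adj.1 hxw)
  have hmem : ℓ ∈ lineSet G 𝒞 x z := (h.mem_lineSet_iff hxz).2 ⟨hℓ, hx, w, hw, hwz.symm⟩
  obtain ⟨m, hm, hne⟩ := h.exists_ne_mem_lineSet hxz hmem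
  exact (Set.one_lt_ncard_iff (Set.toFinite _)).2 ⟨ℓ, m, hmem, hm, hne.symm⟩

theorem isDesign (h : ELSGeometry G 𝒞 φ) {r τ : ℕ} {u v : V} (huv : G.dist u v = 2)
    (hr : ∀ x, {ℓ ∈ 𝒞 | x ∈ ℓ}.ncard = r)
    (hτ : ∀ x z, G.dist x z = 2 → (lineSet G 𝒞 x z).ncard = τ) (x : V) :
    IsDesign 2 r τ 1 {ℓ ∈ 𝒞 | x ∈ ℓ} {b | ∃ z : V, G.dist x z = 2 ∧ b = lineSet G 𝒞 x z} := by
  refine ⟨hτ u v huv ▸ h.two_le_ncard_lineSet huv, ?_, le_rfl, Set.toFinite _, hr x, ?_, ?_⟩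
  · rw [← hτ u v huv, ← hr u]
    exact Set.ncard_le_ncard fun ℓ hℓ => ⟨hℓ.1, hℓ.2.1⟩
  · rintro b ⟨z, hz, rfl⟩
    exact ⟨fun ℓ hℓ => ⟨hℓ.1, hℓ.2.1⟩, hτ x z hz⟩
  · intro T hT hcard
    obtain ⟨ℓ₁, ℓ₂, hne, rfl⟩ := Set.ncard_eq_two.1 hcard
    have h1 : ℓ₁ ∈ 𝒞 ∧ x ∈ ℓ₁ := hT (Set.mem_insert _ _)
    have h2 : ℓ₂ ∈ 𝒞 ∧ x ∈ ℓ₂ := hT (Set.mem_insert_of_mem _ rfl)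
    obtain ⟨z, hz, hz1, hz2⟩ := h.exists_mem_lineSet h1.1 h2.1 hne h1.2 h2.2
    rw [Set.ncard_eq_one]
    refine ⟨lineSet G 𝒞 x z, Set.eq_singleton_iff_unique_mem.2
      ⟨⟨⟨z, hz, rfl⟩, Set.insert_subset hz1 (Set.singleton_subset_iff.2 hz2)⟩, ?_⟩⟩
    rintro b ⟨⟨z', hz', rfl⟩, hb⟩
    exact h.lineSet_unique hz' hz hne (hb (Set.mem_insert _ _))
      (hb (Set.mem_insert_of_mem _ rfl)) hz1 hz2

/-- In the design at u, the blocks joining the outside point C to the τ points of [u, x] share only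
C, and each has τ - 1 further points. -/
theorem mul_add_one_le_ncard_lines (h : ELSGeometry G 𝒞 φ) {τ : ℕ}
    (hτ : ∀ x z, G.dist x z = 2 → (lineSet G 𝒞 x z).ncard = τ) {x y u : V} {C : Set V}
    (hC : C ∈ 𝒞) (hu : u ∈ C) (hy : y ∈ C) (hxy : G.dist x y = 3) (hxu : G.dist x u = 2) :
    τ * (τ - 1) + 1 ≤ {ℓ ∈ 𝒞 | u ∈ ℓ}.ncard := by
  have hux : G.dist u x = 2 := by rwa [G.dist_comm]
  have hCu : C ∉ lineSet G 𝒞 u x := by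
    rw [h.mem_lineSet_iff hux]
    rintro ⟨-, -, p, hp, hxp⟩
    have := two_le_dist_of_mem_clique h.connected (h.isClique C hC) hy hxy hp
    rw [G.dist_eq_one_iff_adj.2 hxp] at this
    omega
  have hex : ∀ ℓ ∈ lineSet G 𝒞 u x,
      ∃ z, G.dist u z = 2 ∧ ℓ ∈ lineSet G 𝒞 u z ∧ C ∈ lineSet G 𝒞 u z := fun ℓ hℓ =>
    h.exists_mem_lineSet hℓ.1 hC (fun e => hCu (e ▸ hℓ)) hℓ.2.1 hu
  have : Nonempty V := ⟨x⟩
  choose! z hz hℓz hCz using hex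
  have hcount := ncard_biUnion_eq_mul (Set.toFinite (lineSet G 𝒞 u x))
    (fun ℓ => lineSet G 𝒞 u (z ℓ) \ {C}) (n := τ - 1) ?_ ?_
  · rw [hτ u x hux] at hcount
    have hCm : C ∉ ⋃ ℓ ∈ lineSet G 𝒞 u x, lineSet G 𝒞 u (z ℓ) \ {C} := by simp
    rw [← hcount, ← Set.ncard_insert_of_notMem hCm]
    refine Set.ncard_le_ncard (Set.insert_subset ⟨hC, hu⟩ ?_)
    exact Set.iUnion₂_subset fun ℓ _ m hm => ⟨hm.1.1, hm.1.2.1⟩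
  · intro ℓ hℓ m hm hne
    -- A second common point n makes the two blocks equal. The resulting block shares ℓ and m with
    -- [u, x], so it is [u, x], which would then contain C.
    refine Set.disjoint_left.2 fun n hn hn' => hCu ?_
    have heq := h.lineSet_unique (hz ℓ hℓ) (hz m hm) (fun e => hn.2 e) hn.1 (hCz ℓ hℓ) hn'.1
      (hCz m hm)
    rw [h.lineSet_unique hux (hz m hm) hne hℓ hm (heq ▸ hℓz ℓ hℓ) (hℓz m hm)]
    exact hCz m hm
  · intro ℓ hℓ
    rw [Set.ncard_sdiff_singleton_of_mem (hCz ℓ hℓ), hτ _ _ (hz ℓ hℓ)]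

/-- Points of a line that leaves the second neighbourhood of `x` have distinct line sets. -/
theorem lineSet_ne (h : ELSGeometry G 𝒞 φ) {x y u v : V} {C : Set V} (hC : C ∈ 𝒞) (hu : u ∈ C)
    (hv : v ∈ C) (hy : y ∈ C) (hxy : G.dist x y = 3) (hxu : G.dist x u = 2)
    (hxv : G.dist x v = 2) (huv : u ≠ v) : lineSet G 𝒞 x u ≠ lineSet G 𝒞 x v := by
  intro heq
  have hCx : ∀ p ∈ C, ¬ G.Adj x p := fun p hp hxp => by
    have := two_le_dist_of_mem_clique h.connected (h.isClique C hC) hy hxy hp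
    rw [G.dist_eq_one_iff_adj.2 hxp] at this
    omega
  have hcommon : ∀ a, G.Adj x a → G.Adj u a → G.Adj v a := by
    intro a hxa hua
    by_contra hva
    obtain ⟨ℓ, hℓ, hx, ha⟩ := h.exists_line hxa
    have hmem : ℓ ∈ lineSet G 𝒞 x u := (h.mem_lineSet_iff hxu).2 ⟨hℓ, hx, a, ha, hua⟩
    rw [heq, h.mem_lineSet_iff hxv] at hmem
    have haC : a ∉ C := fun haC => hCx a haC hxa
    have hay : ¬ G.Adj a y := fun hay => by
      have := dist_le_dist_succ_of_adj h.connected (x := x) hay.symm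
      rw [G.dist_eq_one_iff_adj.2 hxa] at this
      omega
    have huy : u ≠ y := by
      rintro rfl
      omega
    have hav2 : G.dist a v = 2 := dist_eq_two h.connected (fun e => haC (e ▸ hv))
      (fun e => hva e.symm) hua.symm (h.isClique C hC hu hv huv)
    have hay2 : G.dist a y = 2 := dist_eq_two h.connected (fun e => haC (e ▸ hy)) hay hua.symm
      (h.isClique C hC hu hy huy)
    have hℓa : ℓ ∈ lineSet G 𝒞 a v := (h.mem_lineSet_iff hav2).2 ⟨hℓ, ha, hmem.2.2⟩
    -- ELS for a and C moves ℓ from [a, v] to [a, y]. Then y has a neighbour on ℓ, a line through x,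
    -- contradicting d(x, y) = 3.
    rw [h.lineSet_eq hC haC ⟨u, hu, hua.symm⟩ hv hy hav2 hay2, h.mem_lineSet_iff hay2] at hℓa
    obtain ⟨-, -, p, hp, hyp⟩ := hℓa
    have h1 := dist_le_dist_succ_of_adj h.connected (x := x) hyp
    by_cases hxp : x = p
    · rw [← hxp, G.dist_self] at h1
      omega
    · rw [G.dist_eq_one_iff_adj.2 (h.isClique ℓ hℓ hx hp hxp)] at h1
      omega
  obtain ⟨a, hau, hxa⟩ := exists_adj_of_dist_eq_succ h.connected hxu
  rw [G.dist_eq_one_iff_adj] at hxa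
  obtain ⟨n, hn, ha, hun⟩ := h.exists_line hau
  have hxn : x ∉ n := h.notMem_of_dist_eq_two hn hun (G.dist_comm ▸ hxu)
  have hvn : v ∉ n := fun hvn => hCx a (h.line_ext hn hC huv hun hvn hu hv ▸ ha) hxa
  -- On the line n = au the neighbours of x are neighbours of v; equal cardinality forces equality,
  -- yet u is adjacent to v and not to x.
  have hsub : {q ∈ n | G.Adj x q} ⊆ {q ∈ n | G.Adj v q} := by
    rintro q ⟨hq, hxq⟩
    refine ⟨hq, hcommon q hxq (h.isClique n hn hun hq ?_)⟩
    rintro rfl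
    exact not_adj_of_dist_eq_two hxu hxq
  have heq' := Set.eq_of_subset_of_ncard_le hsub
    (by rw [h.ncard_adj n hn x hxn a ha hxa,
      h.ncard_adj n hn v hvn a ha (hcommon a hxa hau.symm)])
  have : u ∈ {q ∈ n | G.Adj x q} := heq' ▸ ⟨hun, h.isClique C hC hv hu huv.symm⟩
  exact not_adj_of_dist_eq_two hxu this.2

/-- Each line ℓ of [x, u] contributes, through one neighbour a ℓ of u on it, φ - 1 vertices of C
other than u. A vertex v contributed by two lines would give [x, u] = [x, v], against `lineSet_ne`.
-/
theorem mul_add_one_le_ncard_dist_two (h : ELSGeometry G 𝒞 φ) {x y u : V} {C : Set V}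
    (hC : C ∈ 𝒞) (hu : u ∈ C) (hy : y ∈ C) (hxy : G.dist x y = 3) (hxu : G.dist x u = 2) :
    (lineSet G 𝒞 x u).ncard * (φ - 1) + 1 ≤ {v ∈ C | G.dist x v = 2}.ncard := by
  have hex : ∀ ℓ ∈ lineSet G 𝒞 x u, ∃ a ∈ ℓ, G.Adj u a := fun ℓ hℓ =>
    ((h.mem_lineSet_iff hxu).1 hℓ).2.2
  have : Nonempty V := ⟨x⟩
  choose! a haℓ hua using hex
  have hxa : ∀ ℓ ∈ lineSet G 𝒞 x u, G.Adj x (a ℓ) := fun ℓ hℓ => by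
    refine h.isClique ℓ hℓ.1 hℓ.2.1 (haℓ ℓ hℓ) fun e => ?_
    exact not_adj_of_dist_eq_two hxu (e ▸ (hua ℓ hℓ).symm)
  have hdist : ∀ ℓ ∈ lineSet G 𝒞 x u, ∀ v ∈ C, G.Adj (a ℓ) v → G.dist x v = 2 := by
    intro ℓ hℓ v hv hav
    have h1 := two_le_dist_of_mem_clique h.connected (h.isClique C hC) hy hxy hv
    have h2 := dist_le_dist_succ_of_adj h.connected (x := x) hav.symm
    rw [G.dist_eq_one_iff_adj.2 (hxa ℓ hℓ)] at h2
    omega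
  have hcount := ncard_biUnion_eq_mul (Set.toFinite (lineSet G 𝒞 x u))
    (fun ℓ => {v ∈ C | G.Adj (a ℓ) v} \ {u}) (n := φ - 1) ?_ ?_
  · have hum : u ∉ ⋃ ℓ ∈ lineSet G 𝒞 x u, {v ∈ C | G.Adj (a ℓ) v} \ {u} := by simp
    rw [← hcount, ← Set.ncard_insert_of_notMem hum]
    refine Set.ncard_le_ncard (Set.insert_subset ⟨hu, hxu⟩ ?_)
    exact Set.iUnion₂_subset fun ℓ hℓ v hv => ⟨hv.1.1, hdist ℓ hℓ v hv.1.1 hv.1.2⟩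
  · intro ℓ hℓ m hm hne
    refine Set.disjoint_left.2 fun v hv hv' => ?_
    have hxv := hdist ℓ hℓ v hv.1.1 hv.1.2
    refine h.lineSet_ne hC hu hv.1.1 hy hxy hxu hxv (fun e => hv.2 e.symm)
      (h.lineSet_unique hxu hxv hne hℓ hm ?_ ?_)
    · exact (h.mem_lineSet_iff hxv).2 ⟨hℓ.1, hℓ.2.1, a ℓ, haℓ ℓ hℓ, hv.1.2.symm⟩
    · exact (h.mem_lineSet_iff hxv).2 ⟨hm.1, hm.2.1, a m, haℓ m hm, hv'.1.2.symm⟩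
  · intro ℓ hℓ
    have haC : a ℓ ∉ C := fun haC => by
      have := two_le_dist_of_mem_clique h.connected (h.isClique C hC) hy hxy haC
      rw [G.dist_eq_one_iff_adj.2 (hxa ℓ hℓ)] at this
      omega
    rw [Set.ncard_sdiff_singleton_of_mem (show u ∈ {v ∈ C | G.Adj (a ℓ) v} from
      ⟨hu, (hua ℓ hℓ).symm⟩), h.ncard_adj C hC _ haC u hu (hua ℓ hℓ).symm]

/-- This is c₂ = τ₂φ₁: the common neighbours are partitioned by the lines joining them to x. -/
theorem ncard_common_neighbors (h : ELSGeometry G 𝒞 φ) {x y : V} (hxy : G.dist x y = 2) :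
    {z | G.Adj y z ∧ G.Adj x z}.ncard = (lineSet G 𝒞 x y).ncard * φ := by
  rw [← ncard_biUnion_eq_mul (Set.toFinite (lineSet G 𝒞 x y)) (fun ℓ => {z ∈ ℓ | G.Adj y z})
    (n := φ)]
  · congr 1
    ext z
    simp only [Set.mem_ofPred_eq, Set.mem_iUnion, exists_prop]
    constructor
    · rintro ⟨hyz, hxz⟩
      obtain ⟨ℓ, hℓ, hx, hz⟩ := h.exists_line hxz
      exact ⟨ℓ, (h.mem_lineSet_iff hxy).2 ⟨hℓ, hx, z, hz, hyz⟩, hz, hyz⟩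
    · rintro ⟨ℓ, hℓ, hz, hyz⟩
      refine ⟨hyz, h.isClique ℓ hℓ.1 hℓ.2.1 hz ?_⟩
      rintro rfl
      exact not_adj_of_dist_eq_two hxy hyz.symm
  · intro ℓ hℓ m hm hne
    refine Set.disjoint_left.2 fun z hz hz' => hne ?_
    refine h.line_ext hℓ.1 hm.1 (x := x) (y := z) ?_ hℓ.2.1 hz.1 hm.2.1 hz'.1
    rintro rfl
    exact not_adj_of_dist_eq_two hxy hz.2.symm
  · intro ℓ hℓ
    obtain ⟨hℓC, hx, p, hp, hyp⟩ := (h.mem_lineSet_iff hxy).1 hℓ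
    exact h.ncard_adj ℓ hℓC y (h.notMem_of_dist_eq_two hℓC hx hxy) p hp hyp

end ELSGeometry

end Geometry

end GeomDRG

/-! ### Spectral argument: constancy of φ_j -/

namespace GeomDRG

section Algebra

open Polynomial Matrix

variable {V : Type*}

open Classical in
/-- On a distance-regular graph, functions of the distance are mapped to functions of the distance
by multiplication with the adjacency matrix. -/
theorem sum_adj_dist [Fintype V] {G : SimpleGraph V} (hG : IsDistanceRegular G) :
    ∃ a b c : ℕ → ℕ, (∀ x y : V, 0 < G.dist x y → 0 < c (G.dist x y)) ∧
      ∀ (e : ℕ → ℝ) (x y : V), ∑ z, G.adjMatrix ℝ y z * e (G.dist x z) =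
        c (G.dist x y) * e (G.dist x y - 1) + a (G.dist x y) * e (G.dist x y) +
          b (G.dist x y) * e (G.dist x y + 1) := by
  obtain ⟨hconn, b, c, hbc⟩ := hG
  obtain ⟨x₀⟩ := hconn.nonempty
  -- `b 0` is the valency. At distance 0 the truncated index `i - 1` is harmless, since `c 0 = 0`.
  refine ⟨fun i => b 0 - c i - b i, b, c, ?_, ?_⟩
  · intro x y hxy
    obtain ⟨i, hi⟩ := Nat.exists_eq_succ_of_ne_zero hxy.ne'
    obtain ⟨z, hzy, hz⟩ := exists_adj_of_dist_eq_succ hconn hi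
    rw [← (hbc _ x y rfl).1, Set.ncard_pos]
    exact ⟨z, hzy.symm, by rw [hz, hi]⟩
  · intro e x y
    set i := G.dist x y with hi
    have hsplit : ∀ z, G.Adj y z → G.dist x z + 1 = i ∨ G.dist x z = i ∨ G.dist x z = i + 1 := by
      intro z hz
      have h1 := dist_le_dist_succ_of_adj hconn (x := x) hz
      have h2 := dist_le_dist_succ_of_adj hconn (x := x) hz.symm
      omega
    have hc : (Finset.univ.filter fun z => G.Adj y z ∧ G.dist x z + 1 = i).card = c i := by
      rw [← (hbc i x y hi.symm).1, Set.ncard_eq_toFinset_card']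
      congr 1; ext; simp
    have hb : (Finset.univ.filter fun z => G.Adj y z ∧ G.dist x z = i + 1).card = b i := by
      rw [← (hbc i x y hi.symm).2, Set.ncard_eq_toFinset_card']
      congr 1; ext; simp
    have hk : (Finset.univ.filter fun z => G.Adj y z).card = b 0 := by
      rw [← (hbc 0 y y (G.dist_self)).2, Set.ncard_eq_toFinset_card']
      congr 1; ext z
      simp [SimpleGraph.dist_eq_one_iff_adj]
    have ha : (Finset.univ.filter fun z => G.Adj y z ∧ G.dist x z = i).card
        = b 0 - c i - b i := by
      have hdis : (Finset.univ.filter fun z => G.Adj y z) =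
          ((Finset.univ.filter fun z => G.Adj y z ∧ G.dist x z + 1 = i) ∪
          (Finset.univ.filter fun z => G.Adj y z ∧ G.dist x z = i + 1)) ∪
          (Finset.univ.filter fun z => G.Adj y z ∧ G.dist x z = i) := by
        ext z
        have := hsplit z
        simp only [Finset.mem_filter, Finset.mem_univ, true_and, Finset.mem_union]
        tauto
      have hcard := congrArg Finset.card hdis
      rw [Finset.card_union_of_disjoint, Finset.card_union_of_disjoint, hk, hc, hb] at hcard
      · omega
      · refine Finset.disjoint_filter.2 fun z _ h1 h2 => ?_
        omega
      · refine Finset.disjoint_union_left.2 ⟨?_, ?_⟩ <;>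
        · refine Finset.disjoint_filter.2 fun z _ h1 h2 => ?_
          omega
    have hterm : ∀ z, G.adjMatrix ℝ y z * e (G.dist x z) =
        (if G.Adj y z ∧ G.dist x z + 1 = i then e (i - 1) else 0) +
        (if G.Adj y z ∧ G.dist x z = i then e i else 0) +
        (if G.Adj y z ∧ G.dist x z = i + 1 then e (i + 1) else 0) := by
      intro z
      rw [SimpleGraph.adjMatrix_apply]
      by_cases hz : G.Adj y z
      · rcases hsplit z hz with h | h | h
        · have h' : G.dist x z = i - 1 := by omega
          have h1 : i - 1 ≠ i := by omega
          have h2 : i - 1 ≠ i + 1 := by omega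
          have h3 : i - 1 + 1 = i := by omega
          simp [hz, h', h1, h2, h3]
        · simp [hz, h]
        · have h2 : i + 1 + 1 ≠ i := by omega
          simp [hz, h, h2]
      · simp [hz]
    simp_rw [hterm, Finset.sum_add_distrib, ← Finset.sum_filter, Finset.sum_const, hc, ha, hb,
      nsmul_eq_mul]

variable [Fintype V]

open Classical in
theorem hasEigenvalue_minEigenvalue (G : SimpleGraph V) [Nonempty V] :
    Module.End.HasEigenvalue (Matrix.mulVecLin (G.adjMatrix ℝ)) (minEigenvalue G) := by
  have hA : (G.adjMatrix ℝ).IsHermitian := by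
    rw [Matrix.IsHermitian, Matrix.conjTranspose_eq_transpose_of_trivial]
    exact G.isSymm_adjMatrix
  refine Set.Nonempty.csInf_mem (s := {θ : ℝ | Module.End.HasEigenvalue
    (Matrix.mulVecLin (G.adjMatrix ℝ)) θ}) ?_ (Module.End.finite_hasEigenvalue _)
  obtain ⟨i⟩ := ‹Nonempty V›
  refine ⟨hA.eigenvalues i, Module.End.hasEigenvalue_of_hasEigenvector
    (x := ⇑(hA.eigenvectorBasis i)) ⟨?_, ?_⟩⟩
  · rw [Module.End.mem_eigenspace_iff]
    exact hA.mulVec_eigenvectorBasis i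
  · intro h0
    exact hA.eigenvectorBasis.orthonormal.ne_zero i (by ext j; exact congrFun h0 j)

open Classical in
/-- A nonzero matrix polynomial in the adjacency matrix whose columns are eigenvectors. -/
theorem exists_eigenmatrix (G : SimpleGraph V) {θ : ℝ}
    (hθ : Module.End.HasEigenvalue (Matrix.mulVecLin (G.adjMatrix ℝ)) θ) :
    ∃ p : ℝ[X], aeval (G.adjMatrix ℝ) p ≠ 0 ∧
      G.adjMatrix ℝ * aeval (G.adjMatrix ℝ) p = θ • aeval (G.adjMatrix ℝ) p := by
  set A := G.adjMatrix ℝ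
  have hint : IsIntegral ℝ A := Algebra.IsIntegral.isIntegral A
  have hroot : (minpoly ℝ A).IsRoot θ := by
    rw [← Matrix.minpoly_toLin']
    exact Module.End.isRoot_of_hasEigenvalue hθ
  -- p is the minimal polynomial divided by X - θ; minimality of the degree keeps p(A) nonzero.
  obtain ⟨p, hp⟩ := dvd_iff_isRoot.2 hroot
  refine ⟨p, fun h0 => ?_, ?_⟩
  · have hp0 : p ≠ 0 := by
      rintro rfl
      exact minpoly.ne_zero hint (by rw [hp, mul_zero])
    have hle := minpoly.degree_le_of_ne_zero ℝ A hp0 h0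
    rw [hp, degree_mul, degree_X_sub_C, degree_eq_natDegree hp0] at hle
    norm_cast at hle
    omega
  · have h0 := minpoly.aeval ℝ A
    rw [hp, map_mul, map_sub, aeval_X, aeval_C, sub_mul, sub_eq_zero] at h0
    rw [h0, Algebra.algebraMap_eq_smul_one, smul_mul_assoc, one_mul]

open Classical in
-- Matrices whose entries depend only on the distance are stable under multiplication by A, by the
-- three-term recurrence.
theorem aeval_adjMatrix_apply {G : SimpleGraph V} (hG : IsDistanceRegular G) (p : ℝ[X]) :
    ∃ e : ℕ → ℝ, ∀ x y, aeval (G.adjMatrix ℝ) p x y = e (G.dist x y) := by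
  obtain ⟨a, b, c, -, habc⟩ := sum_adj_dist hG
  have hmul : ∀ M : Matrix V V ℝ, (∃ e : ℕ → ℝ, ∀ x y, M x y = e (G.dist x y)) →
      ∃ e : ℕ → ℝ, ∀ x y, (M * G.adjMatrix ℝ) x y = e (G.dist x y) := by
    rintro M ⟨e, he⟩
    refine ⟨fun i => c i * e (i - 1) + a i * e i + b i * e (i + 1), fun x y => ?_⟩
    refine Matrix.mul_apply.trans ((Finset.sum_congr rfl fun z _ => ?_).trans (habc e x y))
    rw [he, mul_comm, G.isSymm_adjMatrix.apply]
  induction p using Polynomial.induction_on with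
  | C r =>
    refine ⟨fun i => if i = 0 then r else 0, fun x y => ?_⟩
    rw [aeval_C, Matrix.algebraMap_matrix_apply]
    simp [hG.1.dist_eq_zero_iff]
  | add p q hp hq =>
    obtain ⟨e, he⟩ := hp
    obtain ⟨f, hf⟩ := hq
    exact ⟨fun i => e i + f i, fun x y => by rw [map_add, Matrix.add_apply, he, hf]⟩
  | monomial n r ih =>
    rw [pow_succ, ← mul_assoc, map_mul, aeval_X]
    exact hmul _ ih

open Classical in
/-- The cosine sequence of the smallest eigenvalue: it does not vanish at two consecutive
distances, and its sum over the distances from a vertex to a Delsarte clique vanishes. -/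
theorem exists_cosine_sequence {G : SimpleGraph V} (hG : IsDistanceRegular G)
    (hθ : minEigenvalue G ≠ 0) :
    ∃ e : ℕ → ℝ, (∀ x y : V, ¬ (e (G.dist x y) = 0 ∧ e (G.dist x y + 1) = 0)) ∧
      ∀ (C : Finset V) (x : V), IsDelsarteClique G (C : Set V) →
        ∑ y ∈ C, e (G.dist x y) = 0 := by
  have := hG.1.nonempty
  set A := G.adjMatrix ℝ with hA
  set θ := minEigenvalue G with hθdef
  obtain ⟨p, hp0, hAp⟩ := exists_eigenmatrix G (hasEigenvalue_minEigenvalue G)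
  rw [← hA, ← hθdef] at hAp
  rw [← hA] at hp0
  obtain ⟨e, he⟩ := aeval_adjMatrix_apply hG p
  rw [← hA] at he
  set E := aeval A p with hE
  have hsymm : ∀ x y, E x y = E y x := fun x y => by rw [he, he, G.dist_comm]
  have hqE : ∀ q : ℝ[X], aeval A q * E = q.eval θ • E := by
    intro q
    induction q using Polynomial.induction_on with
    | C r => simp [Algebra.algebraMap_eq_smul_one]
    | add q₁ q₂ h1 h2 => rw [map_add, add_mul, h1, h2, eval_add, add_smul]
    | monomial n r ih =>
      rw [pow_succ, ← mul_assoc, map_mul, aeval_X, mul_assoc, hAp, Matrix.mul_smul, ih, smul_smul,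
        eval_mul, eval_mul_X, eval_mul, mul_comm]
  have hEE : ∀ y z, ∑ x, E x y * E x z = p.eval θ * E y z := by
    intro y z
    have := congrFun (congrFun (hqE p) y) z
    rw [← hE, Matrix.mul_apply, Matrix.smul_apply, smul_eq_mul] at this
    rw [← this]
    exact Finset.sum_congr rfl fun x _ => by rw [hsymm x y]
  have hrec : ∀ x y, ∑ z, A y z * e (G.dist x z) = θ * e (G.dist x y) := by
    intro x y
    have := congrFun (congrFun hAp y) x
    rw [Matrix.mul_apply, Matrix.smul_apply, smul_eq_mul, he, G.dist_comm] at this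
    rw [← this]
    exact Finset.sum_congr rfl fun z _ => by rw [he, G.dist_comm]
  -- E is symmetric and E² = p(θ)E, so a zero diagonal would make every column of E have norm zero.
  have he0 : e 0 ≠ 0 := by
    intro h0
    refine hp0 (Matrix.ext fun x y => ?_)
    have hxx := hEE y y
    rw [he, G.dist_self, h0, mul_zero, Finset.sum_eq_zero_iff_of_nonneg
      fun z _ => mul_self_nonneg _] at hxx
    exact mul_self_eq_zero.1 (hxx x (Finset.mem_univ x))
  refine ⟨e, ?_, ?_⟩
  · obtain ⟨a, b, c, hc, habc⟩ := sum_adj_dist hG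
    -- As c_i > 0 for i > 0, two consecutive zeros propagate down the recurrence to e 0.
    have key : ∀ i, ∀ x y : V, G.dist x y = i → ¬ (e i = 0 ∧ e (i + 1) = 0) := by
      intro i
      induction i with
      | zero => exact fun x y _ h => he0 h.1
      | succ i ih =>
        rintro x y hxy ⟨h1, h2⟩
        obtain ⟨z, -, hz⟩ := exists_adj_of_dist_eq_succ hG.1 hxy
        refine ih x z hz ⟨?_, h1⟩
        have h3 := habc e x y
        rw [← hA, hrec, hxy, h1, h2, mul_zero, mul_zero, mul_zero, add_zero, add_zero,
          Nat.add_sub_cancel] at h3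
        have h4 := hc x y (by omega)
        rw [hxy] at h4
        exact (mul_eq_zero.1 h3.symm).resolve_left (by exact_mod_cast h4.ne')
    exact fun x y => key _ x y rfl
  · rintro C x ⟨hC, k, hk, hcard⟩
    have hk1 : (k : ℝ) * e 1 = θ * e 0 := by
      have h1 := hrec x x
      rw [G.dist_self] at h1
      rw [← h1, ← hk x, Set.ncard_eq_toFinset_card', ← nsmul_eq_mul, ← Finset.sum_const]
      have : ∀ z, A x z * e (G.dist x z) = if G.Adj x z then e 1 else 0 := fun z => by
        rw [hA, SimpleGraph.adjMatrix_apply]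
        by_cases hz : G.Adj x z
        · simp [hz, SimpleGraph.dist_eq_one_iff_adj.2 hz]
        · simp [hz]
      rw [Finset.sum_congr rfl fun z _ => this z, ← Finset.sum_filter]
      refine Finset.sum_congr ?_ fun _ _ => rfl
      ext z; simp
    -- The Delsarte size is exactly what makes e 0 + (|C| - 1) e 1 vanish, given k e 1 = θ e 0.
    have hrow : ∀ y ∈ C, ∑ z ∈ C, E y z = 0 := by
      intro y hy
      rw [← Finset.add_sum_erase C _ hy, he, G.dist_self]
      have : ∀ z ∈ C.erase y, E y z = e 1 := fun z hz => by
        rw [Finset.mem_erase] at hz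
        rw [he, SimpleGraph.dist_eq_one_iff_adj.2 (hC hy hz.2 hz.1.symm)]
      rw [Finset.sum_congr rfl this, Finset.sum_const, nsmul_eq_mul, Finset.card_erase_of_mem hy,
        Nat.cast_sub (Finset.card_pos.2 ⟨y, hy⟩)]
      rw [Set.ncard_coe_finset] at hcard
      rw [hcard]
      push_cast
      have : e 0 + (1 + (k : ℝ) / (-θ) - 1) * e 1 = e 0 - k * e 1 / θ := by
        field_simp
        ring
      rw [this, hk1, mul_div_cancel_left₀ _ hθ, sub_self]
    -- With χ the characteristic vector of C, |Eχ|² = p(θ) χᵀEχ = 0, so Eχ = 0.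
    have hsq : ∑ x, (∑ y ∈ C, E x y) * (∑ y ∈ C, E x y) = 0 := by
      simp_rw [Finset.sum_mul_sum]
      rw [Finset.sum_comm]
      refine Finset.sum_eq_zero fun y hy => ?_
      rw [Finset.sum_comm]
      simp_rw [hEE]
      rw [← Finset.mul_sum, hrow y hy, mul_zero]
    rw [Finset.sum_eq_zero_iff_of_nonneg fun z _ => mul_self_nonneg _] at hsq
    rw [← mul_self_eq_zero.1 (hsq x (Finset.mem_univ x))]
    exact Finset.sum_congr rfl fun y _ => (he x y).symm

/-- Distances from x to C are j or j + 1, so n e_j + (|C| - n) e_{j+1} = 0, where |C| is fixed by k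
and θ_min. This determines n unless e_j = e_{j+1}, in which case both vanish, which is excluded. -/
theorem phiValues_subsingleton {G : SimpleGraph V} (hG : IsDistanceRegular G)
    (hθ : minEigenvalue G < 0) (j : ℕ) : (phiValues G j).Subsingleton := by
  classical
  obtain ⟨e, he, hsum⟩ := exists_cosine_sequence hG hθ.ne
  obtain ⟨x₀⟩ := hG.1.nonempty
  have hkey : ∀ n ∈ phiValues G j, (∃ x y, G.dist x y = j) ∧ ∃ N : ℝ, 0 < N ∧
      N = 1 + ((G.neighborSet x₀).ncard : ℝ) / (-minEigenvalue G) ∧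
      N * e (j + 1) + n * (e j - e (j + 1)) = 0 := by
    rintro n ⟨C, x, hC, hj, rfl⟩
    have hC' := hC
    obtain ⟨hclique, k, hk, hkC⟩ := hC'
    have hcard : (0 : ℝ) < C.ncard := by
      rw [hkC]
      have : 0 ≤ (k : ℝ) / (-minEigenvalue G) := div_nonneg k.cast_nonneg (by linarith)
      linarith
    obtain ⟨y, hy, hxy⟩ := exists_dist_eq_distToSet (G := G) x
      (Set.nonempty_of_ncard_ne_zero (by exact_mod_cast hcard.ne'))
    rw [hj] at hxy
    refine ⟨⟨x, y, hxy⟩, C.ncard, hcard, by rw [hkC, hk x₀], ?_⟩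
    have h0 := hsum C.toFinset x (by simpa using hC)
    have hterm : ∀ z ∈ C.toFinset, e (G.dist x z) =
        e (j + 1) + if G.dist x z = j then e j - e (j + 1) else 0 := by
      intro z hz
      rw [Set.mem_toFinset] at hz
      have h1 := distToSet_le (G := G) (x := x) hz
      have h2 : G.dist x z ≤ j + 1 := by
        by_cases hyz : y = z
        · rw [← hyz]; omega
        · have := dist_le_dist_succ_of_adj hG.1 (x := x) (hclique hz hy (Ne.symm hyz))
          omega
      by_cases hz' : G.dist x z = j
      · simp [hz']
      · have : G.dist x z = j + 1 := by omega
        simp [this]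
    rw [Finset.sum_congr rfl hterm, Finset.sum_add_distrib, ← Finset.sum_filter, Finset.sum_const,
      Finset.sum_const, nsmul_eq_mul, nsmul_eq_mul, ← Set.ncard_eq_toFinset_card'] at h0
    rw [← h0, Set.ncard_eq_toFinset_card' {y ∈ C | G.dist x y = j}]
    congr 4
    ext z
    simp
  intro n hn n' hn'
  obtain ⟨⟨x, y, hxy⟩, N, hN, hNk, hsumN⟩ := hkey n hn
  obtain ⟨-, N', -, hNk', hsumN'⟩ := hkey n' hn'
  obtain rfl : N = N' := hNk.trans hNk'.symm
  have hmul : ((n : ℝ) - n') * (e j - e (j + 1)) = 0 := by linear_combination hsumN - hsumN'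
  rcases mul_eq_zero.1 hmul with h | h
  · exact_mod_cast sub_eq_zero.1 h
  · rw [h, mul_zero, add_zero] at hsumN
    have h1 := (mul_eq_zero.1 hsumN).resolve_left hN.ne'
    exact absurd ⟨by rw [hxy]; linarith, by rw [hxy]; exact h1⟩ (he x y)

end Algebra

end GeomDRG

/-! ### From geometric distance-regular graphs to `ELSGeometry` -/

namespace GeomDRG

section Geometric

variable {V : Type*} {G : SimpleGraph V} {𝒞 : Set (Set V)}

theorem exists_dist_eq_of_le (hG : G.Connected) {x y : V} {i : ℕ} (h : i ≤ G.dist x y) :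
    ∃ z, G.dist x z = i := by
  obtain ⟨n, hn⟩ := Nat.exists_eq_add_of_le h
  induction n generalizing y with
  | zero => exact ⟨y, hn⟩
  | succ n ih =>
    obtain ⟨z, -, hz⟩ := exists_adj_of_dist_eq_succ hG (show G.dist x y = (i + n) + 1 by omega)
    exact ih (by omega) hz

theorem eq_singleton_sInf {S : Set ℕ} (hS : S.Subsingleton) (hne : S.Nonempty) :
    S = {sInf S} :=
  Set.eq_singleton_iff_unique_mem.2 ⟨Nat.sInf_mem hne, fun _ hn => hS hn (Nat.sInf_mem hne)⟩

variable [Fintype V]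

/-- The number of lines through a point. -/
theorem IsGeometric.ncard_lines (hG : IsGeometric G 𝒞) {x y : V} (hxy : G.Adj x y) (z : V) :
    minEigenvalue G < 0 ∧ ({ℓ ∈ 𝒞 | z ∈ ℓ}.ncard : ℝ) = -minEigenvalue G := by
  obtain ⟨-, hDel, hline⟩ := hG
  obtain ⟨C, ⟨hC, hxC, hyC⟩, -⟩ := hline x y hxy
  obtain ⟨hclique, k, hk, hcard⟩ := hDel C hC
  have htwo : 2 ≤ C.ncard := (Set.one_lt_ncard_iff (Set.toFinite _)).2 ⟨x, y, hxC, hyC, hxy.ne⟩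
  have htwo' : (2 : ℝ) ≤ C.ncard := by exact_mod_cast htwo
  have hsize : ∀ ℓ ∈ 𝒞, ℓ.ncard = C.ncard := by
    intro ℓ hℓ
    obtain ⟨-, k', hk', hcard'⟩ := hDel ℓ hℓ
    rw [← hk' x, hk x, ← hcard] at hcard'
    exact_mod_cast hcard'
  -- A line through an edge has at least 2 vertices, while θ_min ≥ 0 would give size at most 1; for
  -- θ_min = 0 the quotient is 0 by convention.
  have hθ : minEigenvalue G < 0 := by
    by_contra hθ
    have : (k : ℝ) / (-minEigenvalue G) ≤ 0 :=
      div_nonpos_of_nonneg_of_nonpos k.cast_nonneg (by linarith)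
    linarith
  refine ⟨hθ, ?_⟩
  -- The lines through z partition its neighbours, so k is their number times |C| - 1 = k /
  -- (-θ_min).
  have hcount := ncard_biUnion_eq_mul (Set.toFinite {ℓ ∈ 𝒞 | z ∈ ℓ}) (fun ℓ => ℓ \ {z})
    (n := C.ncard - 1) ?_ ?_
  · have hunion : (⋃ ℓ ∈ {ℓ ∈ 𝒞 | z ∈ ℓ}, ℓ \ {z}) = G.neighborSet z := by
      ext w
      simp only [Set.mem_iUnion, exists_prop, SimpleGraph.mem_neighborSet]
      constructor
      · rintro ⟨ℓ, ⟨hℓ, hz⟩, hw, hwz⟩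
        exact (hDel ℓ hℓ).1 hz hw fun e => hwz e.symm
      · intro hzw
        obtain ⟨ℓ, ⟨hℓ, hz, hw⟩, -⟩ := hline z w hzw
        exact ⟨ℓ, ⟨hℓ, hz⟩, hw, fun e => hzw.ne e.symm⟩
    rw [hunion, hk z] at hcount
    have hcount' : (k : ℝ) = ({ℓ ∈ 𝒞 | z ∈ ℓ}.ncard : ℝ) * ((C.ncard : ℝ) - 1) := by
      rw [hcount, Nat.cast_mul, Nat.cast_sub (by omega), Nat.cast_one]
    have h1 : (k : ℝ) = ((C.ncard : ℝ) - 1) * (-minEigenvalue G) := by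
      rw [hcard, add_sub_cancel_left, div_mul_cancel₀ _ (by linarith)]
    have h2 : (C.ncard : ℝ) - 1 ≠ 0 := by linarith
    refine mul_left_cancel₀ h2 ?_
    rw [← h1, hcount', mul_comm]
  · intro ℓ hℓ m hm hne
    refine Set.disjoint_left.2 fun w hw hw' => hne ?_
    have hzw : G.Adj z w := (hDel ℓ hℓ.1).1 hℓ.2 hw.1 fun e => hw.2 e.symm
    exact (hline z w hzw).unique ⟨hℓ.1, hℓ.2, hw.1⟩ ⟨hm.1, hm.2, hw'.1⟩
  · intro ℓ hℓ
    rw [Set.ncard_sdiff_singleton_of_mem hℓ.2, hsize ℓ hℓ.1]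

theorem IsGeometric.ncard_eq_of_mem (hG : IsGeometric G 𝒞) {ℓ m : Set V} (hℓ : ℓ ∈ 𝒞)
    (hm : m ∈ 𝒞) : ℓ.ncard = m.ncard := by
  obtain ⟨x⟩ := hG.1.1.nonempty
  obtain ⟨-, k, hk, hcard⟩ := hG.2.1 ℓ hℓ
  obtain ⟨-, k', hk', hcard'⟩ := hG.2.1 m hm
  rw [← hk' x, hk x, ← hcard] at hcard'
  exact_mod_cast hcard'.symm

theorem IsGeometric.phiValues_eq (hG : IsGeometric G 𝒞) {x y : V} {j : ℕ}
    (hxy : G.dist x y = j + 1) : phiValues G j = {phi G j} := by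
  obtain ⟨u, huy, hxu⟩ := exists_adj_of_dist_eq_succ hG.1.1 hxy
  obtain ⟨C, ⟨hC, hu, hy⟩, -⟩ := hG.2.2 u y huy
  refine eq_singleton_sInf (phiValues_subsingleton hG.1 (hG.ncard_lines huy x).1 j)
    ⟨_, C, x, hG.2.1 C hC, distToSet_eq_of_forall_le hu hxu fun v hv => ?_, rfl⟩
  by_cases hyv : y = v
  · rw [← hyv]; omega
  · have := dist_le_dist_succ_of_adj hG.1.1 (x := x) ((hG.2.1 C hC).1 hy hv hyv)
    omega

/-- The line size is where diameter at least 3 enters: on the middle edge's line of a path x, a, u,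
y with d(x, y) = 3, the neighbours of x and of y form disjoint φ₁-sets, so lines have at least 2φ₁ ≥
φ₁ + 2 points. -/
theorem IsGeometric.elsGeometry (hG : IsGeometric G 𝒞) {x y : V} (hxy : G.dist x y = 3)
    (hφ : 2 ≤ phi G 1) (hELS : HasELS G 𝒞) : ELSGeometry G 𝒞 (phi G 1) := by
  have hconn := hG.1.1
  have hadj : ∀ ℓ ∈ 𝒞, ∀ x ∉ ℓ, ∀ y ∈ ℓ, G.Adj x y → {z ∈ ℓ | G.Adj x z}.ncard = phi G 1 := by
    intro ℓ hℓ z hz w hw hzw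
    obtain ⟨u, hu⟩ := exists_dist_eq_of_le hconn (show 1 + 1 ≤ G.dist x y by omega)
    have hmem : {v ∈ ℓ | G.Adj z v}.ncard ∈ phiValues G 1 := by
      refine ⟨ℓ, z, hG.2.1 ℓ hℓ, (distToSet_eq_one_iff hconn).2 ⟨hz, w, hw, hzw⟩, ?_⟩
      simp_rw [SimpleGraph.dist_eq_one_iff_adj]
    rw [hG.phiValues_eq hu] at hmem
    exact hmem
  refine ⟨hconn, fun ℓ hℓ => (hG.2.1 ℓ hℓ).1, hG.2.2, hadj, hφ, fun ℓ hℓ => ?_, hELS⟩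
  obtain ⟨u, huy, hxu⟩ := exists_adj_of_dist_eq_succ hconn hxy
  obtain ⟨a, hau, hxa⟩ := exists_adj_of_dist_eq_succ hconn hxu
  obtain ⟨n, ⟨hn, ha, hu⟩, -⟩ := hG.2.2 a u hau
  rw [hG.ncard_eq_of_mem hℓ hn]
  have hclique := (hG.2.1 n hn).1
  have hxn : x ∉ n := fun hx => not_adj_of_dist_eq_two hxu
    (hclique hx hu (ne_of_dist_eq_two hxu))
  have hyn : y ∉ n := fun hy => by
    have := dist_le_dist_succ_of_adj hconn (x := x) (hclique hy ha (fun e => by subst e; omega))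
    omega
  have h1 := hadj n hn x hxn a ha (SimpleGraph.dist_eq_one_iff_adj.1 hxa)
  have h2 := hadj n hn y hyn u hu huy.symm
  have hdisj : Disjoint {z ∈ n | G.Adj x z} {z ∈ n | G.Adj y z} := by
    refine Set.disjoint_left.2 fun z hz hz' => ?_
    have := dist_le_dist_succ_of_adj hconn (x := x) hz'.2
    rw [SimpleGraph.dist_eq_one_iff_adj.2 hz.2] at this
    omega
  have h3 := Set.ncard_union_eq hdisj
  have h4 : ({z ∈ n | G.Adj x z} ∪ {z ∈ n | G.Adj y z}).ncard ≤ n.ncard :=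
    Set.ncard_le_ncard (Set.union_subset (fun z hz => hz.1) fun z hz => hz.1)
  omega

theorem ELSGeometry.tauValues_subsingleton {φ : ℕ} (h : ELSGeometry G 𝒞 φ)
    (hG : IsDistanceRegular G) : (tauValues G 𝒞 2).Subsingleton := by
  obtain ⟨-, b, c, hbc⟩ := hG
  have key : ∀ n ∈ tauValues G 𝒞 2, n * φ = c 2 := by
    rintro n ⟨x, y, hxy, rfl⟩
    have h1 := h.ncard_common_neighbors hxy
    have h2 := (hbc 2 x y hxy).1
    simp only [Nat.reduceEqDiff, SimpleGraph.dist_eq_one_iff_adj] at h2 ⊢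
    rw [← h2, h1]
    rfl
  intro n hn n' hn'
  exact Nat.eq_of_mul_eq_mul_right (by have := h.two_le; omega) ((key n hn).trans (key n' hn').symm)

end Geometric

end GeomDRG

theorem mainTheorem7 {V : Type*} [Fintype V] (G : SimpleGraph V) (𝒞 : Set (Set V))
    (hG : GeomDRG.IsGeometric G 𝒞) (hD : 3 ≤ G.diam)
    (hφ : 2 ≤ GeomDRG.phi G 1) (hELS : GeomDRG.HasELS G 𝒞) :
    -- the parameters involved are well defined
    (GeomDRG.phiValues G 1 = {GeomDRG.phi G 1} ∧
      GeomDRG.phiValues G 2 = {GeomDRG.phi G 2} ∧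
      GeomDRG.tauValues G 𝒞 2 = {GeomDRG.tau G 𝒞 2}) ∧
    ∃ r : ℕ, (r : ℝ) = -GeomDRG.minEigenvalue G ∧
      (∀ x : V, GeomDRG.IsDesign 2 r (GeomDRG.tau G 𝒞 2) 1
        {ℓ ∈ 𝒞 | x ∈ ℓ} {b | ∃ z : V, G.dist x z = 2 ∧ b = GeomDRG.lineSet G 𝒞 x z}) ∧
      (GeomDRG.tau G 𝒞 2 : ℤ) * ((GeomDRG.tau G 𝒞 2 : ℤ) - 1) + 1 ≤ (r : ℤ) ∧
      (GeomDRG.tau G 𝒞 2 : ℤ) * ((GeomDRG.phi G 1 : ℤ) - 1) + 1 ≤ (GeomDRG.phi G 2 : ℤ) := by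
  have hconn := hG.1.1
  have := hconn.nonempty
  obtain ⟨x, y', hdiam⟩ := G.exists_dist_eq_diam
  obtain ⟨y, hxy⟩ := GeomDRG.exists_dist_eq_of_le hconn (hD.trans hdiam.ge)
  obtain ⟨u, huy, hxu⟩ := GeomDRG.exists_adj_of_dist_eq_succ hconn hxy
  obtain ⟨C, ⟨hC, hu, hy⟩, -⟩ := hG.2.2 u y huy
  have h := hG.elsGeometry hxy hφ hELS
  have htau : GeomDRG.tauValues G 𝒞 2 = {GeomDRG.tau G 𝒞 2} :=
    GeomDRG.eq_singleton_sInf (h.tauValues_subsingleton hG.1) ⟨_, x, u, hxu, rfl⟩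
  have hphi1 := hG.phiValues_eq hxu
  have hphi2 := hG.phiValues_eq hxy
  have hτ : ∀ x z, G.dist x z = 2 →
      (GeomDRG.lineSet G 𝒞 x z).ncard = GeomDRG.tau G 𝒞 2 := by
    intro x z hxz
    have hmem : (GeomDRG.lineSet G 𝒞 x z).ncard ∈ GeomDRG.tauValues G 𝒞 2 := by
      refine ⟨x, z, hxz, ?_⟩
      simp only [Nat.reduceEqDiff]
      rfl
    rw [htau] at hmem
    exact hmem
  have hr : ∀ z, {ℓ ∈ 𝒞 | z ∈ ℓ}.ncard = {ℓ ∈ 𝒞 | u ∈ ℓ}.ncard := fun z => by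
    exact_mod_cast (hG.ncard_lines huy z).2.trans (hG.ncard_lines huy u).2.symm
  have hτ2 := hτ x u hxu ▸ h.two_le_ncard_lineSet hxu
  refine ⟨⟨hphi1, hphi2, htau⟩, {ℓ ∈ 𝒞 | u ∈ ℓ}.ncard, (hG.ncard_lines huy u).2,
    h.isDesign hxu hr hτ, ?_, ?_⟩
  · have h1 := h.mul_add_one_le_ncard_lines hτ hC hu hy hxy hxu
    -- Since τ₂ ≥ 2, the truncated τ₂ - 1 agrees with the integer difference.
    zify [show 1 ≤ GeomDRG.tau G 𝒞 2 by omega] at h1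
    exact h1
  · have h1 := h.mul_add_one_le_ncard_dist_two hC hu hy hxy hxu
    have hmem : {v ∈ C | G.dist x v = 2}.ncard ∈ GeomDRG.phiValues G 2 :=
      ⟨C, x, hG.2.1 C hC, GeomDRG.distToSet_eq_of_forall_le hu hxu fun v hv =>
        GeomDRG.two_le_dist_of_mem_clique hconn (h.isClique C hC) hy hxy hv, rfl⟩
    rw [hphi2, Set.mem_singleton_iff] at hmem
    rw [hmem, hτ x u hxu] at h1
    zify [show 1 ≤ GeomDRG.phi G 1 by omega] at h1
    exact h1
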